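/- Let $G$ be an infinite compact (Hausdorff) abelian group with normalized Haar measure and dual group $\Gamma$, let $L_p=L_p(G)$ be its complex Lebesgue spaces, and let $P(G)$ be the space of trigonometric polynomials (linear combinations of characters). Write $C^0(G)$ and $L_p^0(G)$ for $P(G)$ with the supremum norm and with the $L_p$-norm, respectively; $L_1(G)$ acts on $P(G)$ and on $L_q(G)$ by convolution. Let $\varphi:[0,\infty)\to\mathbb R$ be a Lipschitz function with $\varphi(0)=0$ that is unbounded and essentially concave, i.e. non-negative and concave on some interval $[t,\infty)$. On the space $\ell_2^0(\Gamma)$ of finitely supported functions $c:\Gamma\to\mathbb C$ let $$\Omega(c)(\gamma)=c(\gamma)\,\varphi\!\left(\log\frac{\|c\|_2}{|c(\gamma)|}\right)$$ (equal to $0$ where $c(\gamma)=0$) be the associated Kalton–Peck map, and for $f\in P(G)$ put $\mho(f)=\mathscr F^{-1}(\Omega(\mathscr F f))$, where $\mathscr F f=\widehat f$ is the Fourier transform. Write $\mho^{\infty1}:C^0(G)\to L_1(G)$ and $\mho^{pq}:L_p^0(G)\to L_q(G)$ for this same map between the indicated spaces. Let $X$ be $C^0(G)$ or $L_p^0(G)$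 and let $Y=L_q(G)$. A map $\Phi:X\to Y$ is an $L_1(G)$-centralizer if it is homogeneous ($\Phi(\lambda f)=\lambda\Phi(f)$ for $\lambda\in\mathbb C$) and there are constants $Q,C$ with $\|\Phi(f+g)-\Phi(f)-\Phi(g)\|_Y\le Q(\|f\|_X+\|g\|_X)$ and $\|\Phi(a*f)-a*\Phi(f)\|_Y\le C\|a\|_1\|f\|_X$ for all $f,g\in X$ and $a\in L_1(G)$. It is trivial as a quasilinear map if there are a (not necessarily continuous) linear map $\Lambda:X\to Y$ and a constant $K$ with $\|\Phi(f)-\Lambda(f)\|_Y\le K\|f\|_X$ for all $f\in X$, and trivial as a centralizer if moreover $\Lambda$ can be chosen with $\Lambda(a*f)=a*\Lambda(f)$ for all $a\in L_1(G)$ and $f\in X$. Then $\mho^{\infty 1}:C^0(G)\to L_1(G)$ is an $L_1(G)$-centralizer that is nontrivial, both as a quasilinear map and as a centralizer; and the same holds for $\mho^{pq}:L_p^0(G)\to L_q(G)$ for all $1\le q\le 2\le p\le\infty$. -/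

import Mathlib

open MeasureTheory
open scoped ENNReal ComplexConjugate

noncomputable section

namespace KaltonPeck

section Harmonic

variable {G : Type*} [CommGroup G] [TopologicalSpace G]

/-- A character of `G`, as a continuous complex-valued function on `G`. -/
def charMap (γ : PontryaginDual G) : C(G, ℂ) where
  toFun x := (γ x : ℂ)
  continuous_toFun := continuous_subtype_val.comp (map_continuous γ)

variable (G) in
/-- The space `P(G)` of (trigonometric) polynomials: linear combinations of characters. It is the
underlying vector space of `C⁰(G)` and of all the spaces `L_p⁰(G) = L_p(G) ∩ P(G)`. -/
def trigPoly : Submodule ℂ C(G, ℂ) :=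
  Submodule.span ℂ (Set.range (charMap (G := G)))

variable [MeasurableSpace G]

/-- The Fourier coefficient `∫ x, f x * conj (γ x)`. -/
def fourierCoef (μ : Measure G) (f : G → ℂ) (γ : PontryaginDual G) : ℂ :=
  ∫ x, f x * conj (γ x : ℂ) ∂μ

/-- The convolution `(a * f)(x) = ∫ a (x y⁻¹) f y dy`. -/
def conv (μ : Measure G) (a f : G → ℂ) (x : G) : ℂ :=
  ∫ y, a (x * y⁻¹) * f y ∂μ

variable [IsTopologicalGroup G] [CompactSpace G] [BorelSpace G]
  (μ : Measure G) [μ.IsHaarMeasure]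

lemma integral_char_mul_conj (γ η : PontryaginDual G) (h : η ≠ γ) :
    ∫ x, (η x : ℂ) * conj (γ x : ℂ) ∂μ = 0 := by
  obtain ⟨y, hy⟩ : ∃ y, η y ≠ γ y := by
    by_contra! hc
    exact h (PontryaginDual.ext hc)
  have hinv := integral_mul_left_eq_self (μ := μ) (fun x => (η x : ℂ) * conj (γ x : ℂ)) y
  have hstep : ∀ x, (η (y * x) : ℂ) * conj (γ (y * x) : ℂ)
      = ((η y : ℂ) * conj (γ y : ℂ)) * ((η x : ℂ) * conj (γ x : ℂ)) := by
    intro x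
    simp only [map_mul, Circle.coe_mul]
    ring
  simp only [hstep] at hinv
  rw [integral_const_mul] at hinv
  by_contra hne
  have h1 : (η y : ℂ) * conj (γ y : ℂ) = 1 := by
    have := mul_right_cancel₀ hne (hinv.trans (one_mul _).symm)
    exact this
  apply hy
  rw [← Circle.coe_inv_eq_conj, ← Circle.coe_mul, Circle.coe_eq_one, ← div_eq_mul_inv,
    div_eq_one] at h1
  exact h1

lemma finite_support_fourierCoef (f : trigPoly G) :
    (Function.support (fourierCoef μ (f : C(G, ℂ)))).Finite := by
  obtain ⟨f, hf⟩ := f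
  have hint : ∀ (g : C(G, ℂ)) (γ : PontryaginDual G),
      Integrable (fun x => g x * conj (γ x : ℂ)) μ := by
    intro g γ
    refine Continuous.integrable_of_hasCompactSupport ?_ (HasCompactSupport.of_compactSpace _)
    exact g.continuous.mul (Complex.continuous_conj.comp (charMap γ).continuous)
  induction hf using Submodule.span_induction with
  | mem f hf =>
    obtain ⟨η, rfl⟩ := hf
    refine (Set.finite_singleton η).subset fun γ hγ => ?_
    by_contra hne
    exact hγ (integral_char_mul_conj μ γ η fun h => hne h.symm)
  | zero => simp [fourierCoef, Function.support]
  | add f g _ _ hf hg =>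
    refine (hf.union hg).subset fun γ hγ => ?_
    by_contra hne
    simp only [Set.mem_union, Function.mem_support, not_or, not_not] at hne
    apply hγ
    have : fourierCoef μ (⇑(f + g)) γ = fourierCoef μ f γ + fourierCoef μ g γ := by
      simp only [fourierCoef, ContinuousMap.add_apply, add_mul]
      exact integral_add (hint f γ) (hint g γ)
    exact this.trans (by rw [hne.1, hne.2, add_zero])
  | smul c f _ hf =>
    refine hf.subset fun γ hγ => ?_
    intro h0
    apply hγ
    have : fourierCoef μ (⇑(c • f)) γ = c * fourierCoef μ f γ := by
      simp only [fourierCoef, ContinuousMap.smul_apply, smul_eq_mul, mul_assoc]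
      exact integral_const_mul _ _
    exact this.trans (mul_eq_zero_of_right c h0)

/-- The Fourier transform `P(G) → ℓ₂⁰(Γ)`; finitely supported families on `Γ` are elements of
`Γ →₀ ℂ`. -/
def fourier (f : trigPoly G) : PontryaginDual G →₀ ℂ :=
  Finsupp.ofSupportFinite (fourierCoef μ (f : C(G, ℂ))) (finite_support_fourierCoef μ f)

lemma conv_char (a : G → ℂ) (γ : PontryaginDual G) (x : G) :
    conv μ a (charMap γ) x = fourierCoef μ a γ * (γ x : ℂ) := by
  have h := integral_div_left_eq_self (fun z => a z * conj (γ z : ℂ)) μ x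
  rw [fourierCoef, ← h, ← integral_mul_const, conv]
  congr 1
  ext y
  have : (γ y : ℂ) = conj (γ (x / y) : ℂ) * (γ x : ℂ) := by
    rw [← Circle.coe_inv_eq_conj, ← Circle.coe_mul, map_div]
    simp
  rw [div_eq_mul_inv] at *
  change a (x * y⁻¹) * (γ y : ℂ) = _
  rw [this, mul_assoc]

lemma exists_conv_eq (a : Lp ℂ 1 μ) (f : trigPoly G) :
    ∃ g ∈ trigPoly G, ∀ x, g x = conv μ a (f : C(G, ℂ)) x := by
  obtain ⟨f, hf⟩ := f
  have hint : ∀ (g : C(G, ℂ)) (x : G), Integrable (fun y => a (x * y⁻¹) * g y) μ := by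
    intro g x
    have ha : Integrable (fun y => a (x / y)) μ := (L1.integrable_coeFn a).comp_div_left x
    simp only [div_eq_mul_inv] at ha
    exact ha.mul_of_top_left (Continuous.memLp_of_hasCompactSupport g.continuous
      (HasCompactSupport.of_compactSpace _))
  induction hf using Submodule.span_induction with
  | mem f hf =>
    obtain ⟨η, rfl⟩ := hf
    refine ⟨fourierCoef μ a η • charMap η,
      Submodule.smul_mem _ _ (Submodule.subset_span ⟨η, rfl⟩), fun x => ?_⟩
    exact (conv_char μ a η x).symm
  | zero => exact ⟨0, Submodule.zero_mem _, fun x => by simp [conv]⟩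
  | add f g _ _ hf hg =>
    obtain ⟨f', hf', hf⟩ := hf
    obtain ⟨g', hg', hg⟩ := hg
    refine ⟨f' + g', Submodule.add_mem _ hf' hg', fun x => ?_⟩
    simp only [ContinuousMap.add_apply, hf, hg, conv, mul_add]
    exact (integral_add (hint f x) (hint g x)).symm
  | smul c f _ hf =>
    obtain ⟨f', hf', hf⟩ := hf
    refine ⟨c • f', Submodule.smul_mem _ _ hf', fun x => ?_⟩
    simp only [ContinuousMap.smul_apply, hf, conv, smul_eq_mul, mul_left_comm _ c]
    exact (integral_const_mul _ _).symm

/-- The action of `L₁(G)` on `P(G)` by convolution; see `convPoly_apply`. -/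
def convPoly (a : Lp ℂ 1 μ) (f : trigPoly G) : trigPoly G :=
  ⟨(exists_conv_eq μ a f).choose, (exists_conv_eq μ a f).choose_spec.1⟩

lemma convPoly_apply (a : Lp ℂ 1 μ) (f : trigPoly G) (x : G) :
    (convPoly μ a f : C(G, ℂ)) x = conv μ a (f : C(G, ℂ)) x :=
  (exists_conv_eq μ a f).choose_spec.2 x

/-- The inclusion of the continuous functions into `L_q(G)`. -/
def toLq (q : ℝ≥0∞) (f : C(G, ℂ)) : Lp ℂ q μ :=
  MemLp.toLp f (Continuous.memLp_of_hasCompactSupport f.continuous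
    (HasCompactSupport.of_compactSpace _))

end Harmonic

section KaltonPeckMap

/-- `φ`, regarded as a function on `[0, ∞)`, is Lipschitz, vanishes at `0`, and is non-negative and
concave on some interval `[t, ∞)`. -/
structure IsEssentiallyConcave (φ : ℝ → ℝ) : Prop where
  lipschitz : ∃ L : NNReal, LipschitzOnWith L φ (Set.Ici 0)
  map_zero : φ 0 = 0
  concave_tail : ∃ t : ℝ, 0 ≤ t ∧ (∀ s ∈ Set.Ici t, 0 ≤ φ s) ∧ ConcaveOn ℝ (Set.Ici t) φ

/-- The norm of `ℓ₂(I)` on finitely supported families. -/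
def l2norm {I : Type*} (c : I →₀ ℂ) : ℝ :=
  Real.sqrt (c.sum fun _ z => ‖z‖ ^ 2)

/-- The Kalton-Peck map `Ω(c) = c φ(log (‖c‖₂ / |c|))` on `ℓ₂⁰(I)`, computed pointwise
(with value `0` where `c` vanishes). -/
def kaltonPeck {I : Type*} (φ : ℝ → ℝ) (c : I →₀ ℂ) : I →₀ ℂ :=
  c.mapRange (fun z => z * (φ (Real.log (l2norm c / ‖z‖)) : ℂ)) (zero_mul _)

end KaltonPeckMap

section Centralizers

variable {G : Type*} [CommGroup G] [TopologicalSpace G] [MeasurableSpace G]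
  [IsTopologicalGroup G] [CompactSpace G] [BorelSpace G]
  (μ : Measure G) [μ.IsHaarMeasure]

/-- The inverse Fourier transform `ℓ₂⁰(Γ) → P(G)`. -/
def invFourier (c : PontryaginDual G →₀ ℂ) : C(G, ℂ) :=
  c.sum fun γ z => z • charMap γ

/-- The map `𝓕⁻¹ ∘ Ω ∘ 𝓕` from `P(G)` to `L_q(G)`, `Ω` being the Kalton-Peck map induced by `φ`. -/
def mho (φ : ℝ → ℝ) (q : ℝ≥0∞) (f : trigPoly G) : Lp ℂ q μ :=
  toLq μ q (invFourier (kaltonPeck φ (fourier μ f)))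

/-- The norm of `C⁰(G)`: the supremum norm on `P(G)`. -/
def supNorm (f : trigPoly G) : ℝ := ‖(f : C(G, ℂ))‖

/-- The norm of `L_p⁰(G)`: the `L_p`-norm on `P(G)`. -/
def polyLpNorm (p : ℝ≥0∞) (f : trigPoly G) : ℝ := ‖toLq μ p (f : C(G, ℂ))‖

variable {μ} {q : ℝ≥0∞}

/-- `Φ : (P(G), N) → L_q(G)` is quasilinear. -/
def IsQuasilinear (N : trigPoly G → ℝ) (Φ : trigPoly G → Lp ℂ q μ) : Prop :=
  (∀ (c : ℂ) (f : trigPoly G), Φ (c • f) = c • Φ f) ∧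
    ∃ Q : ℝ, ∀ f g : trigPoly G, ‖Φ (f + g) - Φ f - Φ g‖ ≤ Q * (N f + N g)

/-- `Φ : (P(G), N) → L_q(G)` is an `L₁(G)`-centralizer: it is quasilinear and
`‖Φ (a * f) - a * Φ f‖_q ≤ C ‖a‖₁ N(f)`, where `*` denotes convolution. -/
def IsCentralizer (N : trigPoly G → ℝ) (Φ : trigPoly G → Lp ℂ q μ) : Prop :=
  IsQuasilinear N Φ ∧
    ∃ C : ℝ, ∀ (a : Lp ℂ 1 μ) (f : trigPoly G),
      eLpNorm (fun x => Φ (convPoly μ a f) x - conv μ a (Φ f) x) q μ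
        ≤ ENNReal.ofReal (C * ‖a‖ * N f)

/-- `Φ` is trivial as a quasilinear map: it is at bounded distance from a (not necessarily
continuous) linear map. -/
def IsTrivialQuasilinear (N : trigPoly G → ℝ) (Φ : trigPoly G → Lp ℂ q μ) : Prop :=
  ∃ (L : trigPoly G →ₗ[ℂ] Lp ℂ q μ) (K : ℝ), ∀ f : trigPoly G, ‖Φ f - L f‖ ≤ K * N f

/-- `Φ` is trivial as an `L₁(G)`-centralizer: it is at bounded distance from a (not necessarily
continuous) morphism of `L₁(G)`-modules. -/
def IsTrivialCentralizer (N : trigPoly G → ℝ) (Φ : trigPoly G → Lp ℂ q μ) : Prop :=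
  ∃ (L : trigPoly G →ₗ[ℂ] Lp ℂ q μ) (K : ℝ),
    (∀ (a : Lp ℂ 1 μ) (f : trigPoly G), L (convPoly μ a f) =ᵐ[μ] conv μ a (L f)) ∧
      ∀ f : trigPoly G, ‖Φ f - L f‖ ≤ K * N f

end Centralizers

end KaltonPeck

end

/-!
`℧` is a centralizer because it is one for the `L₂`-norm, which lies between the norms of source and
target. By Plancherel this is a statement about the Kalton-Peck map `Ω` on `ℓ₂⁰(Γ)` and bounded
multipliers; it follows from the Lipschitz condition on `φ` and the inequality `x log (s / x) ≤ s`,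
which allow one to replace the argument of `φ` in every term by a common one
(`l2norm_kaltonPeck_add_sub_sub_le`, `l2norm_kaltonPeck_mul_sub_le`).

For nontriviality it is enough to treat linear maps `Λ` with `‖℧ f - Λ f‖ ≤ K ‖f‖_∞`. Averaging
`⟨(℧ - Λ) f_x, f_x⟩` over all translates `f_x` of a polynomial `f` removes the off-diagonal
coefficients of `Λ`, and the diagonal ones are bounded by `K` since `℧` vanishes on characters.
If `f` has `n` Fourier coefficients, all of modulus one, then `℧ f = φ(log √n) f`; if moreover
`‖f‖_∞² ≤ 2 n`, the average gives `|φ(log √n)| ≤ 3 K` (`abs_phi_le_of_isFlat`). Such polynomials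
exist for all `n = 2 ^ k` by the Rudin-Shapiro recursion in the dual group (`exists_rudinShapiro`),
so that `φ` would be bounded.

The recursion needs infinitely many characters of `G` (`infinite_pontryaginDual`). If there were only
finitely many, some nonzero continuous `k` would be orthogonal to all of them. Convolution with `k`
is then a nonzero operator on `L₂(G)`, and Gelfand duality for the commutative C⋆-algebra generated
by it and by the translations yields a character `χ` that does not vanish on it; but the values of
`χ` on translations form a continuous character `γ` of `G`, for which `χ` of the convolution operator
is `∫ k γ` (`exists_integral_mul_ne_zero`).
-/

set_option linter.unusedSectionVars false
set_option linter.overlappingInstances false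

open MeasureTheory
open scoped ENNReal ComplexConjugate

noncomputable section

namespace KaltonPeck

/-! ### Characters of commutative C⋆-algebras and of compact groups -/

section Gelfand

/-- Gelfand duality: in the commutative C⋆-algebra generated by a set of elements that commute with
each other and with each other's adjoints, every nonzero generator is detected by a character. -/
lemma exists_character_ne_zero {A : Type*} [CStarAlgebra A] {s : Set A}
    (hs : ∀ a ∈ s, ∀ b ∈ s, a * b = b * a) (hs' : ∀ a ∈ s, ∀ b ∈ s, a * star b = star b * a)
    {t : A} (ht : t ∈ s) (h0 : t ≠ 0) :
    ∃ χ : (StarAlgebra.adjoin ℂ s).topologicalClosure →A[ℂ] ℂ,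
      (∀ a, ‖χ a‖ ≤ ‖a‖) ∧
      χ ⟨t, StarSubalgebra.le_topologicalClosure _ (StarAlgebra.subset_adjoin ℂ s ht)⟩ ≠ 0 := by
  have hc := StarAlgebra.isMulCommutative_adjoin ℂ hs hs'
  let B := (StarAlgebra.adjoin ℂ s).topologicalClosure
  have hcl : IsClosed (B : Set A) := StarSubalgebra.isClosed_topologicalClosure _
  let _ : CStarAlgebra B := StarSubalgebra.cstarAlgebra B (h_closed := hcl)
  have hB : ∀ x y : B, x * y = y * x :=
    (StarSubalgebra.commRingTopologicalClosure (StarAlgebra.adjoin ℂ s)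
      fun x y => hc.is_comm.comm x y).mul_comm
  let _ : CommCStarAlgebra B := { ‹CStarAlgebra B› with mul_comm := hB }
  let t' : B := ⟨t, StarSubalgebra.le_topologicalClosure _ (StarAlgebra.subset_adjoin ℂ s ht)⟩
  have ht' : t' ≠ 0 := fun h => h0 (congrArg Subtype.val h)
  have hg : WeakDual.gelfandTransform ℂ B t' ≠ 0 := by
    intro h
    exact ht' ((gelfandTransform_isometry B).injective (h.trans (map_zero _).symm))
  have : Nontrivial A := ⟨t, 0, h0⟩
  have : NormOneClass B := ⟨CStarRing.norm_one (E := A)⟩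
  obtain ⟨χ, hχ⟩ := DFunLike.ne_iff.1 hg
  refine ⟨⟨WeakDual.CharacterSpace.toAlgHom χ, map_continuous χ⟩, fun a => ?_, hχ⟩
  exact spectrum.norm_le_norm_of_mem (AlgHom.apply_mem_spectrum χ a)

end Gelfand

section Smear

lemma integrable_of_continuous {X E : Type*} [TopologicalSpace X] [CompactSpace X]
    [MeasurableSpace X] [BorelSpace X] (μ : Measure X) [IsFiniteMeasure μ] [NormedAddCommGroup E]
    {f : X → E} (hf : Continuous f) : Integrable f μ :=
  hf.integrable_of_hasCompactSupport (HasCompactSupport.of_compactSpace _)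

variable {G : Type*} [CommGroup G] [TopologicalSpace G] [IsTopologicalGroup G] [CompactSpace G]
  [MeasurableSpace G] [BorelSpace G] (μ : Measure G) [IsProbabilityMeasure μ]
  {H : Type*} [NormedAddCommGroup H] [InnerProductSpace ℂ H] [CompleteSpace H]
  (U : G →* unitary (H →L[ℂ] H))

lemma norm_unitary_apply (u : unitary (H →L[ℂ] H)) (f : H) : ‖(u : H →L[ℂ] H) f‖ = ‖f‖ :=
  (Unitary.linearIsometryEquiv u).norm_map f

variable {U}

lemma integrable_smul_unitary (hU : ∀ f, Continuous fun x => (U x : H →L[ℂ] H) f)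
    (k : C(G, ℂ)) (f : H) :
    Integrable (fun y => k y • (U y : H →L[ℂ] H) f) μ :=
  integrable_of_continuous μ (k.continuous.smul (hU f))

variable (hU : ∀ f, Continuous fun x => (U x : H →L[ℂ] H) f)

/-- The operator `∫ k(y) U(y) dμ(y)` attached to a continuous function `k` on `G` by a strongly
continuous unitary representation `U`. -/
def smear (k : C(G, ℂ)) : H →L[ℂ] H :=
  LinearMap.mkContinuous
    { toFun f := ∫ y, k y • (U y : H →L[ℂ] H) f ∂μ
      map_add' f g := by
        simp only [map_add, smul_add]
        exact integral_add (integrable_smul_unitary μ hU k f)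
          (integrable_smul_unitary μ hU k g)
      map_smul' c f := by
        simp only [map_smul, smul_comm _ c, integral_smul, RingHom.id_apply] }
    ‖k‖ fun f => by
      refine (norm_integral_le_of_norm_le_const (C := ‖k‖ * ‖f‖) (.of_forall fun y => ?_)).trans
        (by simp)
      rw [norm_smul, norm_unitary_apply]
      gcongr
      exact k.norm_coe_le_norm y

lemma smear_apply (k : C(G, ℂ)) (f : H) :
    smear μ hU k f = ∫ y, k y • (U y : H →L[ℂ] H) f ∂μ := rfl

lemma norm_smear_sub_le (k l : C(G, ℂ)) : ‖smear μ hU k - smear μ hU l‖ ≤ ‖k - l‖ := by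
  have : smear μ hU k - smear μ hU l = smear μ hU (k - l) := by
    ext1 f
    simp only [sub_apply, smear_apply, ContinuousMap.sub_apply, sub_smul]
    exact (integral_sub (integrable_smul_unitary μ hU k f)
          (integrable_smul_unitary μ hU l f)).symm
  rw [this]
  exact LinearMap.mkContinuous_norm_le _ (norm_nonneg _) _

/-- Whatever commutes with the representation commutes with its smeared operators. -/
lemma mul_smear_comm {S : H →L[ℂ] H} (hS : ∀ x, S * U x = U x * S) (k : C(G, ℂ)) :
    S * smear μ hU k = smear μ hU k * S := by
  ext1 f
  simp only [mul_apply_eq_comp, smear_apply]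
  rw [← S.integral_comp_comm (integrable_smul_unitary μ hU k f)]
  congr 1
  ext1 y
  rw [map_smul]
  exact congrArg _ (DFunLike.congr_fun (hS y) f)

lemma continuous_mul_smear [μ.IsHaarMeasure] (k : C(G, ℂ)) :
    Continuous fun x => (U x : H →L[ℂ] H) * smear μ hU k := by
  let τ : C(G, C(G, ℂ)) := ContinuousMap.curry ⟨fun p : G × G => k (p.1⁻¹ * p.2), by fun_prop⟩
  have h1 : ∀ x, (U x : H →L[ℂ] H) * smear μ hU k = smear μ hU (τ x) := by
    intro x
    ext1 f
    simp only [mul_apply_eq_comp, smear_apply]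
    rw [← ContinuousLinearMap.integral_comp_comm _
      (integrable_smul_unitary μ hU k f)]
    rw [← integral_mul_left_eq_self (μ := μ) (fun y => τ x y • (U y : H →L[ℂ] H) f) x]
    congr 1
    ext1 y
    simp [τ]
  simp only [h1]
  have h2 : LipschitzWith 1 (smear μ hU) := LipschitzWith.of_dist_le_mul fun k l => by
    simpa [dist_eq_norm] using norm_smear_sub_le μ hU k l
  exact h2.continuous.comp τ.continuous

/-- A function `k` that acts nontrivially in some unitary representation has a nonzero Fourier
coefficient: the commutative C⋆-algebra generated by the representation and its smeared operators
has a character that does not vanish on `smear k`, and restricting it to the representation gives a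
continuous character `γ` of `G` with `χ (smear k) = ∫ k γ`. -/
lemma exists_integral_mul_ne_zero [μ.IsHaarMeasure] {k : C(G, ℂ)} (hk : smear μ hU k ≠ 0) :
    ∃ γ : PontryaginDual G, ∫ y, k y * (γ y : ℂ) ∂μ ≠ 0 := by
  let s : Set (H →L[ℂ] H) :=
    insert (smear μ hU k) (Set.range fun x => (U x : H →L[ℂ] H))
  have hUU : ∀ x y, (U x : H →L[ℂ] H) * U y = U y * U x := fun x y => by
    have := congrArg (Subtype.val) (map_mul U x y)
    have h2 := congrArg (Subtype.val) (map_mul U y x)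
    rw [mul_comm] at h2
    exact this.symm.trans h2
  have hstar : ∀ x, star (U x : H →L[ℂ] H) = U x⁻¹ := fun x => by
    rw [map_inv, ← Unitary.star_eq_inv]
    rfl
  have hTU : ∀ x, (U x : H →L[ℂ] H) * smear μ hU k = smear μ hU k * U x := fun x =>
    mul_smear_comm μ hU (fun y => hUU x y) k
  have hTU' : ∀ x, star (smear μ hU k) * (U x : H →L[ℂ] H) = U x * star (smear μ hU k) := by
    intro x
    have := congrArg star (hTU x⁻¹)
    rw [star_mul, star_mul, hstar, inv_inv] at this
    exact this
  have hs : ∀ a ∈ s, ∀ b ∈ s, a * b = b * a := by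
    rintro a (rfl | ⟨x, rfl⟩) b (rfl | ⟨y, rfl⟩)
    exacts [rfl, (hTU y).symm, hTU x, hUU x y]
  have hs' : ∀ a ∈ s, ∀ b ∈ s, a * star b = star b * a := by
    rintro a (rfl | ⟨x, rfl⟩) b (rfl | ⟨y, rfl⟩)
    · exact (mul_smear_comm μ hU hTU' k).symm
    · simp only [hstar]
      exact (hTU _).symm
    · exact (hTU' x).symm
    · simp only [hstar]
      exact hUU _ _
  let B := (StarAlgebra.adjoin ℂ s).topologicalClosure
  obtain ⟨χ, hχ, hne⟩ : ∃ χ : B →A[ℂ] ℂ, (∀ a, ‖χ a‖ ≤ ‖a‖) ∧ χ _ ≠ 0 :=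
    exists_character_ne_zero hs hs' (Set.mem_insert _ _) hk
  have hmem : ∀ a ∈ s, a ∈ B := fun a ha =>
    StarSubalgebra.le_topologicalClosure _ (StarAlgebra.subset_adjoin ℂ s ha)
  let t : B := ⟨smear μ hU k, hmem _ (Set.mem_insert _ _)⟩
  let u : G → B := fun x => ⟨U x, hmem _ (Set.mem_insert_of_mem _ ⟨x, rfl⟩)⟩
  have hu_one : u 1 = 1 := Subtype.ext (by simp [u])
  have hu_mul : ∀ x y, u (x * y) = u x * u y := fun x y => Subtype.ext (by simp [u])
  have hle : ∀ x, ‖χ (u x)‖ ≤ 1 := fun x =>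
    (hχ _).trans (ContinuousLinearMap.opNorm_le_bound _ zero_le_one fun f =>
      (norm_unitary_apply (U x) f).le.trans (one_mul _).ge)
  have hnorm : ∀ x, ‖χ (u x)‖ = 1 := by
    intro x
    have h1 : ‖χ (u x)‖ * ‖χ (u x⁻¹)‖ = 1 := by
      rw [← norm_mul, ← map_mul, ← hu_mul, mul_inv_cancel, hu_one, map_one, norm_one]
    refine le_antisymm (hle x) ?_
    nlinarith [hle x⁻¹, norm_nonneg (χ (u x))]
  have hut : Continuous fun x => u x * t :=
    Continuous.subtype_mk (continuous_mul_smear μ hU k) _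
  have hcont : Continuous fun x => χ (u x) := by
    have : (fun x => χ (u x)) = fun x => χ (u x * t) / χ t := by
      ext1 x
      rw [map_mul, mul_div_cancel_right₀ _ hne]
    rw [this]
    exact (χ.continuous.comp hut).div_const _
  let γ : G →ₜ* Circle :=
    { toFun x := ⟨χ (u x), mem_sphere_zero_iff_norm.2 (hnorm x)⟩
      map_one' := by ext; simp [hu_one]
      map_mul' x y := Circle.ext ((congrArg χ (hu_mul x y)).trans (map_mul χ _ _))
      continuous_toFun := hcont.subtype_mk _ }
  refine ⟨γ, fun h0 => hne ?_⟩
  have hint : Integrable (fun y => k y • (u y * t)) μ :=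
    integrable_of_continuous μ (k.continuous.smul hut)
  have htt : t * t = ∫ y, k y • (u y * t) ∂μ := by
    let ι : B →L[ℂ] (H →L[ℂ] H) := ⟨B.subtype.toLinearMap, continuous_subtype_val⟩
    refine Subtype.ext ?_
    change _ = ι _
    rw [← ι.integral_comp_comm hint]
    ext1 f
    rw [ContinuousLinearMap.integral_apply (ι.integrable_comp hint)]
    rfl
  let χL : B →L[ℂ] ℂ := ⟨χ.toAlgHom.toLinearMap, χ.continuous⟩
  have h2 : χ t * χ t = (∫ y, k y * χ (u y) ∂μ) * χ t := by
    rw [← map_mul, htt]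
    change χL _ = _
    rw [← χL.integral_comp_comm hint, ← integral_mul_const]
    congr 1
    ext1 y
    change χ _ = _
    rw [map_smul, map_mul, smul_eq_mul, mul_assoc]
  have h3 : (∫ y, k y * χ (u y) ∂μ) = 0 := h0
  rw [h3, zero_mul] at h2
  exact mul_self_eq_zero.1 h2

end Smear

/-! ### The dual of an infinite compact group is infinite -/

section InfiniteDual

variable {G : Type*} [CommGroup G] [TopologicalSpace G] [IsTopologicalGroup G] [CompactSpace G]
  [T2Space G] [MeasurableSpace G] [BorelSpace G] (μ : Measure G) [μ.IsHaarMeasure]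
  [IsProbabilityMeasure μ] [μ.Regular]

/-- The regular representation of `G` on `L₂(G)`, `U(x) f = f(x ·)`. -/
def regularRep : G →* unitary (Lp ℂ 2 μ →L[ℂ] Lp ℂ 2 μ) :=
  (Unitary.linearIsometryEquiv (𝕜 := ℂ) (H := Lp ℂ 2 μ)).symm.toMonoidHom.comp
    { toFun x := ⟨DistribMulAction.toLinearEquiv ℂ (Lp ℂ 2 μ) (DomMulAct.mk x),
        fun f => DomMulAct.norm_smul_Lp _ f⟩
      map_one' := by
        ext1 f
        exact one_smul (Gᵈᵐᵃ) f
      map_mul' x y := by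
        ext1 f
        rw [mul_comm]
        exact mul_smul (α := Gᵈᵐᵃ) (DomMulAct.mk x) (DomMulAct.mk y) f }

lemma regularRep_apply (x : G) (f : Lp ℂ 2 μ) :
    (regularRep μ x : Lp ℂ 2 μ →L[ℂ] Lp ℂ 2 μ) f = DomMulAct.mk x • f := rfl

lemma continuous_regularRep (f : Lp ℂ 2 μ) :
    Continuous fun x => (regularRep μ x : Lp ℂ 2 μ →L[ℂ] Lp ℂ 2 μ) f := by
  have : Fact ((2 : ℝ≥0∞) ≠ ∞) := ⟨by simp⟩
  simp only [regularRep_apply]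
  exact (show Continuous (DomMulAct.mk : G → _) from DomMulAct.continuous_mk).smul
    continuous_const

/-- The regular representation is faithful on continuous functions: `smear k` maps `conj k` to the
class of a continuous function whose value at `1` is `∫ |k|²`. -/
lemma smear_regularRep_ne_zero {k : C(G, ℂ)} (hk : k ≠ 0) :
    smear μ (continuous_regularRep μ) k ≠ 0 := by
  intro h0
  let τ : C(G, C(G, ℂ)) :=
    ContinuousMap.curry ⟨fun p : G × G => conj (k (p.1 * p.2)), by fun_prop⟩
  have hint : Integrable (fun y => k y • τ y) μ :=
    integrable_of_continuous μ (k.continuous.smul τ.continuous)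
  let J := ContinuousMap.toLp (E := ℂ) 2 μ ℂ
  have h1 : smear μ (continuous_regularRep μ) k (J (τ 1)) = J (∫ y, k y • τ y ∂μ) := by
    rw [smear_apply, ← J.integral_comp_comm hint]
    congr 1
    ext1 y
    rw [map_smul]
    congr 1
    rw [regularRep_apply]
    refine (DomMulAct.mk_smul_toLp (f := τ 1) y ((τ 1).continuous.memLp_of_hasCompactSupport
      (HasCompactSupport.of_compactSpace _))).trans ?_
    refine MemLp.toLp_congr _ ((τ y).continuous.memLp_of_hasCompactSupport
      (HasCompactSupport.of_compactSpace _)) (.of_forall fun x => ?_)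
    simp [τ]
  rw [h0, zero_apply] at h1
  have h2 : ∫ y, k y • τ y ∂μ = 0 :=
    ContinuousMap.toLp_injective (p := 2) (𝕜 := ℂ) μ (h1.symm.trans (map_zero J).symm)
  have h3 := congrArg (ContinuousMap.evalCLM ℂ (1 : G)) h2
  rw [← ContinuousLinearMap.integral_comp_comm _ hint] at h3
  have h4 : ∀ y, ContinuousMap.evalCLM ℂ (1 : G) (k y • τ y) = ((‖k y‖ ^ 2 : ℝ) : ℂ) := by
    intro y
    simp [τ, Complex.mul_conj, Complex.normSq_eq_norm_sq]
  simp only [h4, map_zero] at h3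
  rw [integral_complex_ofReal, Complex.ofReal_eq_zero] at h3
  apply hk
  have hc : Continuous fun y => ‖k y‖ ^ 2 := by fun_prop
  ext x
  by_contra hx
  exact (hc.integral_pos_of_hasCompactSupport_nonneg_nonzero (μ := μ) (x := x)
    (HasCompactSupport.of_compactSpace _) (fun y => by positivity) (by simpa using hx)).ne' h3

/-- An infinite compact Hausdorff abelian group has infinitely many characters: otherwise the
infinite-dimensional space `C(G)` would contain a nonzero function orthogonal to all of them. -/
lemma infinite_pontryaginDual {G : Type*} [CommGroup G] [TopologicalSpace G] [IsTopologicalGroup G]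
    [CompactSpace G] [T2Space G] [MeasurableSpace G] [BorelSpace G] (μ : Measure G)
    [μ.IsHaarMeasure] [IsProbabilityMeasure μ] [μ.Regular] [Infinite G] :
    Infinite (PontryaginDual G) := by
  by_contra hfin
  rw [not_infinite_iff_finite] at hfin
  have := Fintype.ofFinite (PontryaginDual G)
  let Ψ : C(G, ℂ) →ₗ[ℂ] (PontryaginDual G → ℂ) :=
    { toFun k γ := ∫ y, k y * (γ y : ℂ) ∂μ
      map_add' k l := by
        ext γ
        simp only [ContinuousMap.add_apply, add_mul, Pi.add_apply]
        exact integral_add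
          (integrable_of_continuous μ (k.continuous.mul (charMap γ).continuous))
          (integrable_of_continuous μ (l.continuous.mul (charMap γ).continuous))
      map_smul' c k := by
        ext γ
        simp only [ContinuousMap.smul_apply, smul_eq_mul, mul_assoc, RingHom.id_apply,
          Pi.smul_apply]
        exact integral_const_mul _ _ }
  have hinj : Function.Injective Ψ := by
    rw [injective_iff_map_eq_zero]
    intro k hk
    by_contra hne
    obtain ⟨γ, hγ⟩ := exists_integral_mul_ne_zero μ _ (smear_regularRep_ne_zero μ hne)
    exact hγ (congrFun hk γ)
  have hfd : Module.Finite ℂ C(G, ℂ) := Module.Finite.of_injective Ψ hinj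
  obtain ⟨s, hs⟩ := Infinite.exists_subset_card_eq G (Module.finrank ℂ C(G, ℂ) + 1)
  let R : C(G, ℂ) →ₗ[ℂ] (s → ℂ) :=
    { toFun k x := k x
      map_add' _ _ := rfl
      map_smul' _ _ := rfl }
  have hsurj : Function.Surjective R := by
    intro g
    obtain ⟨k, hk⟩ := ContinuousMap.exists_restrict_eq (s := (s : Set G)) s.finite_toSet.isClosed
      (⟨g, continuous_of_discreteTopology⟩ : C((s : Set G), ℂ))
    exact ⟨k, funext fun x => DFunLike.congr_fun hk x⟩
  have := LinearMap.finrank_le_finrank_of_surjective (f := R) hsurj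
  rw [Module.finrank_fintype_fun_eq_card, Fintype.card_coe] at this
  omega

end InfiniteDual

/-! ### The norm of finitely supported families and the Kalton-Peck map -/

section L2Norm

variable {I : Type*}

lemma l2norm_eq {c : I →₀ ℂ} {s : Finset I} (hs : c.support ⊆ s) :
    l2norm c = Real.sqrt (∑ i ∈ s, ‖c i‖ ^ 2) := by
  rw [l2norm, Finsupp.sum_of_support_subset _ hs _ (by simp)]

lemma l2norm_nonneg (c : I →₀ ℂ) : 0 ≤ l2norm c := Real.sqrt_nonneg _

@[simp]
lemma l2norm_zero : l2norm (0 : I →₀ ℂ) = 0 := by simp [l2norm]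

lemma norm_apply_le_l2norm (c : I →₀ ℂ) (i : I) : ‖c i‖ ≤ l2norm c := by
  classical
  rw [l2norm_eq (Finset.subset_insert i c.support)]
  refine Real.le_sqrt_of_sq_le ?_
  exact Finset.single_le_sum (f := fun i => ‖c i‖ ^ 2) (fun _ _ => by positivity)
    (Finset.mem_insert_self _ _)

/-- Monotonicity and the triangle inequality for the `ℓ₂`-norm in one statement. -/
lemma l2norm_le_of_norm_le {c d e : I →₀ ℂ} {M : ℝ} (hM : 0 ≤ M)
    (h : ∀ i, ‖e i‖ ≤ M * (‖c i‖ + ‖d i‖)) : l2norm e ≤ M * (l2norm c + l2norm d) := by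
  classical
  let s := c.support ∪ d.support ∪ e.support
  have hc : l2norm c = Real.sqrt (∑ i ∈ s, ‖c i‖ ^ 2) := l2norm_eq (by grind)
  have hd : l2norm d = Real.sqrt (∑ i ∈ s, ‖d i‖ ^ 2) := l2norm_eq (by grind)
  have he : l2norm e = Real.sqrt (∑ i ∈ s, ‖e i‖ ^ 2) := l2norm_eq (by grind)
  have hcd := Real.sum_mul_le_sqrt_mul_sqrt s (fun i => ‖c i‖) (fun i => ‖d i‖)
  rw [← hc, ← hd] at hcd
  have hc2 : l2norm c ^ 2 = ∑ i ∈ s, ‖c i‖ ^ 2 := by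
    rw [hc, Real.sq_sqrt (Finset.sum_nonneg fun _ _ => by positivity)]
  have hd2 : l2norm d ^ 2 = ∑ i ∈ s, ‖d i‖ ^ 2 := by
    rw [hd, Real.sq_sqrt (Finset.sum_nonneg fun _ _ => by positivity)]
  rw [he]
  refine Real.sqrt_le_iff.2 ⟨mul_nonneg hM (add_nonneg (l2norm_nonneg c) (l2norm_nonneg d)), ?_⟩
  calc ∑ i ∈ s, ‖e i‖ ^ 2 ≤ ∑ i ∈ s, (M * (‖c i‖ + ‖d i‖)) ^ 2 := by
        gcongr with i
        exact h i
    _ = M ^ 2 * (∑ i ∈ s, ‖c i‖ ^ 2 + 2 * ∑ i ∈ s, ‖c i‖ * ‖d i‖ + ∑ i ∈ s, ‖d i‖ ^ 2) := by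
        simp only [Finset.mul_sum, ← Finset.sum_add_distrib]
        exact Finset.sum_congr rfl fun i _ => by ring
    _ ≤ M ^ 2 * (l2norm c ^ 2 + 2 * (l2norm c * l2norm d) + l2norm d ^ 2) := by
        rw [hc2, hd2]
        gcongr
    _ = _ := by ring

lemma l2norm_add_le (c d : I →₀ ℂ) : l2norm (c + d) ≤ l2norm c + l2norm d := by
  simpa using l2norm_le_of_norm_le (c := c) (d := d) (e := c + d) zero_le_one
    (fun i => by simpa using norm_add_le (c i) (d i))

lemma l2norm_le_mul {c e : I →₀ ℂ} {M : ℝ} (hM : 0 ≤ M) (h : ∀ i, ‖e i‖ ≤ M * ‖c i‖) :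
    l2norm e ≤ M * l2norm c := by
  simpa using l2norm_le_of_norm_le (c := c) (d := 0) (e := e) hM (by simpa using h)

lemma l2norm_sub_comm (c d : I →₀ ℂ) : l2norm (c - d) = l2norm (d - c) := by
  have h : ∀ c d : I →₀ ℂ, l2norm (c - d) ≤ l2norm (d - c) := fun c d => by
    simpa using l2norm_le_mul (c := d - c) (e := c - d) zero_le_one
      (fun i => by simp [norm_sub_rev])
  exact (h c d).antisymm (h d c)

lemma l2norm_smul (a : ℂ) (c : I →₀ ℂ) : l2norm (a • c) = ‖a‖ * l2norm c := by
  rw [l2norm_eq (Finsupp.support_smul (b := a) (g := c)),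
    l2norm_eq (subset_refl c.support), ← Real.sqrt_sq (norm_nonneg a),
    ← Real.sqrt_mul (by positivity), Finset.mul_sum]
  simp [mul_pow]

lemma l2norm_pos {c : I →₀ ℂ} (hc : c ≠ 0) : 0 < l2norm c := by
  obtain ⟨i, hi⟩ := DFunLike.ne_iff.1 hc
  exact (norm_pos_iff.2 hi).trans_le (norm_apply_le_l2norm c i)

end L2Norm

section KaltonPeckEstimates

variable {I : Type*} {φ : ℝ → ℝ}

lemma kaltonPeck_smul (a : ℂ) (c : I →₀ ℂ) :
    kaltonPeck φ (a • c) = a • kaltonPeck φ c := by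
  ext i
  rcases eq_or_ne a 0 with rfl | ha
  · simp [kaltonPeck]
  · simp only [kaltonPeck, Finsupp.mapRange_apply, Finsupp.smul_apply, smul_eq_mul, norm_mul,
      l2norm_smul]
    rw [mul_div_mul_left _ _ (norm_ne_zero_iff.2 ha), mul_assoc]

/-- The Kalton-Peck map with the norm `‖c‖₂` replaced by a fixed number `N`. -/
def kaltonPeckAt (φ : ℝ → ℝ) (N : ℝ) (c : I →₀ ℂ) : I →₀ ℂ :=
  c.mapRange (fun z => z * (φ (Real.log (N / ‖z‖)) : ℂ)) (zero_mul _)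

variable {L : NNReal} (hφ : LipschitzOnWith L φ (Set.Ici 0))
include hφ

/-- The value of `φ` at `log (N / |z|)` may be replaced by its value at `log (N / s)` for any
`s ≥ |z|`, since `x log (s / x) ≤ s`. -/
lemma norm_mul_sub_mul_le {z : ℂ} {s N : ℝ} (hzs : ‖z‖ ≤ s) (hsN : s ≤ N) :
    ‖z * (φ (Real.log (N / ‖z‖)) : ℂ) - z * (φ (Real.log (N / s)) : ℂ)‖ ≤ L * s := by
  rcases eq_or_ne z 0 with rfl | hz
  · simpa using mul_nonneg L.2 ((norm_nonneg _).trans hzs)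
  have hz0 : 0 < ‖z‖ := norm_pos_iff.2 hz
  have hs0 : 0 < s := hz0.trans_le hzs
  have hN0 : 0 < N := hs0.trans_le hsN
  have h1 : 0 ≤ Real.log (N / ‖z‖) :=
    Real.log_nonneg ((one_le_div hz0).2 (hzs.trans hsN))
  have h2 : 0 ≤ Real.log (N / s) := Real.log_nonneg ((one_le_div hs0).2 hsN)
  have h3 := hφ.dist_le_mul _ h1 _ h2
  have h4 : Real.log (N / ‖z‖) - Real.log (N / s) = Real.log (s / ‖z‖) := by
    rw [Real.log_div hN0.ne' hz0.ne', Real.log_div hN0.ne' hs0.ne',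
      Real.log_div hs0.ne' hz0.ne']
    ring
  have h5 : 0 ≤ Real.log (s / ‖z‖) := Real.log_nonneg ((one_le_div hz0).2 hzs)
  have h6 : Real.log (s / ‖z‖) ≤ s / ‖z‖ :=
    (Real.log_le_sub_one_of_pos (by positivity)).trans (by linarith)
  rw [Real.dist_eq, Real.dist_eq, h4, abs_of_nonneg h5] at h3
  rw [← mul_sub, norm_mul, ← Complex.ofReal_sub, Complex.norm_real, Real.norm_eq_abs]
  calc ‖z‖ * _ ≤ ‖z‖ * (L * (s / ‖z‖)) := by
        gcongr
        exact h3.trans (by gcongr)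
    _ = L * s := by field_simp

lemma l2norm_kaltonPeckAt_sub_le (c : I →₀ ℂ) {N : ℝ} (hN : l2norm c ≤ N) :
    l2norm (kaltonPeckAt φ N c - kaltonPeck φ c) ≤ L * N := by
  rcases eq_or_ne c 0 with rfl | hc
  · have : kaltonPeckAt φ N (0 : I →₀ ℂ) - kaltonPeck φ (0 : I →₀ ℂ) = 0 := by
      simp [kaltonPeckAt, kaltonPeck]
    rw [this]
    simpa using mul_nonneg L.2 ((l2norm_nonneg _).trans hN)
  have hc0 := l2norm_pos hc
  have hN0 : 0 < N := hc0.trans_le hN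
  have h5 : 0 ≤ Real.log (N / l2norm c) := Real.log_nonneg ((one_le_div hc0).2 hN)
  have h6 : Real.log (N / l2norm c) ≤ N / l2norm c :=
    (Real.log_le_sub_one_of_pos (by positivity)).trans (by linarith)
  calc _ ≤ (L * Real.log (N / l2norm c)) * l2norm c := ?_
    _ ≤ (L * (N / l2norm c)) * l2norm c := by gcongr
    _ = L * N := by field_simp
  refine l2norm_le_mul (mul_nonneg L.2 h5) fun i => ?_
  rcases eq_or_ne (c i) 0 with hi | hi
  · simp [kaltonPeckAt, kaltonPeck, hi]
  have hz0 : 0 < ‖c i‖ := norm_pos_iff.2 hi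
  have hzc := norm_apply_le_l2norm c i
  have h1 : 0 ≤ Real.log (N / ‖c i‖) := Real.log_nonneg ((one_le_div hz0).2 (hzc.trans hN))
  have h2 : 0 ≤ Real.log (l2norm c / ‖c i‖) := Real.log_nonneg ((one_le_div hz0).2 hzc)
  have h3 := hφ.dist_le_mul _ h1 _ h2
  have h4 : Real.log (N / ‖c i‖) - Real.log (l2norm c / ‖c i‖) = Real.log (N / l2norm c) := by
    rw [Real.log_div hN0.ne' hz0.ne', Real.log_div hc0.ne' hz0.ne',
      Real.log_div hN0.ne' hc0.ne']
    ring
  rw [Real.dist_eq, Real.dist_eq, h4, abs_of_nonneg h5] at h3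
  simp only [kaltonPeckAt, kaltonPeck, Finsupp.sub_apply, Finsupp.mapRange_apply]
  rw [← mul_sub, norm_mul, ← Complex.ofReal_sub, Complex.norm_real, Real.norm_eq_abs, mul_comm]
  gcongr

/-- The Kalton-Peck map is quasilinear. All three terms are first normalized by the common number
`N = ‖c‖₂ + ‖d‖₂`, and then the three values of `φ` in each coordinate are replaced by the one
belonging to `|c i| + |d i|`. -/
lemma l2norm_kaltonPeck_add_sub_sub_le (c d : I →₀ ℂ) :
    l2norm (kaltonPeck φ (c + d) - kaltonPeck φ c - kaltonPeck φ d)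
      ≤ 6 * L * (l2norm c + l2norm d) := by
  set N := l2norm c + l2norm d with hN
  have hc := l2norm_nonneg c
  have hd := l2norm_nonneg d
  have h1 := l2norm_kaltonPeckAt_sub_le hφ (c + d) (l2norm_add_le c d)
  have h2 := l2norm_kaltonPeckAt_sub_le hφ c (N := N) (by linarith)
  have h3 := l2norm_kaltonPeckAt_sub_le hφ d (N := N) (by linarith)
  have h4 : l2norm (kaltonPeckAt φ N (c + d) - kaltonPeckAt φ N c - kaltonPeckAt φ N d)
      ≤ (3 * L) * (l2norm c + l2norm d) := by
    refine l2norm_le_of_norm_le (by positivity) fun i => ?_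
    have hci := norm_apply_le_l2norm c i
    have hdi := norm_apply_le_l2norm d i
    have hcn := norm_nonneg (c i)
    have hdn := norm_nonneg (d i)
    have k1 := norm_mul_sub_mul_le hφ (norm_add_le (c i) (d i)) (N := N) (by linarith)
    have k2 := norm_mul_sub_mul_le hφ (z := c i) (s := ‖c i‖ + ‖d i‖) (N := N)
      (by linarith) (by linarith)
    have k3 := norm_mul_sub_mul_le hφ (z := d i) (s := ‖c i‖ + ‖d i‖) (N := N)
      (by linarith) (by linarith)
    simp only [kaltonPeckAt, Finsupp.sub_apply, Finsupp.mapRange_apply, Finsupp.add_apply]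
    set r : ℂ := (φ (Real.log (N / (‖c i‖ + ‖d i‖))) : ℂ)
    have e : ∀ a b b' : ℂ, a - b - b' = (a - (c i + d i) * r) - (b - c i * r) - (b' - d i * r) :=
      fun a b b' => by ring
    rw [e]
    refine (norm_sub_le _ _).trans ?_
    refine (add_le_add_left (norm_sub_le _ _) _).trans ?_
    linarith
  have e : kaltonPeck φ (c + d) - kaltonPeck φ c - kaltonPeck φ d
      = (kaltonPeckAt φ N (c + d) - kaltonPeckAt φ N c - kaltonPeckAt φ N d)
        + ((kaltonPeck φ (c + d) - kaltonPeckAt φ N (c + d))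
          + ((kaltonPeckAt φ N c - kaltonPeck φ c) + (kaltonPeckAt φ N d - kaltonPeck φ d))) := by
    abel
  rw [e]
  rw [l2norm_sub_comm] at h1
  refine (l2norm_add_le _ _).trans ?_
  have a1 := l2norm_add_le (kaltonPeck φ (c + d) - kaltonPeckAt φ N (c + d))
    ((kaltonPeckAt φ N c - kaltonPeck φ c) + (kaltonPeckAt φ N d - kaltonPeck φ d))
  have a2 := l2norm_add_le (kaltonPeckAt φ N c - kaltonPeck φ c)
    (kaltonPeckAt φ N d - kaltonPeck φ d)
  rw [← hN] at h1 h4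
  linarith

/-- The Kalton-Peck map commutes with bounded multipliers up to a bounded error. -/
lemma l2norm_kaltonPeck_mul_sub_le {c d e : I →₀ ℂ} {m : I → ℂ} {M : ℝ}
    (hm : ∀ i, ‖m i‖ ≤ M) (hM : 0 ≤ M) (hd : ∀ i, d i = m i * c i)
    (he : ∀ i, e i = m i * kaltonPeck φ c i) :
    l2norm (kaltonPeck φ d - e) ≤ 2 * L * M * l2norm c := by
  have hdi : ∀ i, ‖d i‖ ≤ M * ‖c i‖ := fun i => by
    rw [hd, norm_mul]
    exact mul_le_mul_of_nonneg_right (hm i) (norm_nonneg _)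
  have hdc : l2norm d ≤ M * l2norm c := l2norm_le_mul hM hdi
  have h1 := l2norm_kaltonPeckAt_sub_le hφ d hdc
  have h2 : l2norm (kaltonPeckAt φ (M * l2norm c) d - e) ≤ (L * M) * l2norm c := by
    refine l2norm_le_mul (by positivity) fun i => ?_
    have h3 := norm_mul_sub_mul_le hφ (hdi i) (N := M * l2norm c)
      (mul_le_mul_of_nonneg_left (norm_apply_le_l2norm c i) hM)
    have h4 : e i = d i * (φ (Real.log (M * l2norm c / (M * ‖c i‖))) : ℂ) := by
      rw [he, hd]
      simp only [kaltonPeck, Finsupp.mapRange_apply]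
      rcases eq_or_ne (m i) 0 with h0 | h0
      · simp [h0]
      · have hM0 : M ≠ 0 := ((norm_pos_iff.2 h0).trans_le (hm i)).ne'
        rw [mul_div_mul_left _ _ hM0, mul_assoc]
    simp only [kaltonPeckAt, Finsupp.sub_apply, Finsupp.mapRange_apply]
    rw [h4, mul_assoc]
    exact h3
  have e1 : kaltonPeck φ d - e = (kaltonPeck φ d - kaltonPeckAt φ (M * l2norm c) d)
      + (kaltonPeckAt φ (M * l2norm c) d - e) := by abel
  rw [e1]
  rw [l2norm_sub_comm] at h1
  refine (l2norm_add_le _ _).trans ?_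
  linarith

end KaltonPeckEstimates

/-! ### Fourier coefficients, Plancherel, and the centralizer property -/

section Fourier

variable {G : Type*} [CommGroup G] [TopologicalSpace G]

lemma invFourier_mem (c : PontryaginDual G →₀ ℂ) : invFourier c ∈ trigPoly G :=
  Submodule.sum_mem _ fun γ _ =>
    Submodule.smul_mem _ _ (Submodule.subset_span ⟨γ, rfl⟩)

lemma invFourier_add (c d : PontryaginDual G →₀ ℂ) :
    invFourier (c + d) = invFourier c + invFourier d := map_add (Finsupp.linearCombination _ _) c d

lemma invFourier_sub (c d : PontryaginDual G →₀ ℂ) :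
    invFourier (c - d) = invFourier c - invFourier d := map_sub (Finsupp.linearCombination _ _) c d

lemma invFourier_smul (a : ℂ) (c : PontryaginDual G →₀ ℂ) :
    invFourier (a • c) = a • invFourier c := map_smul (Finsupp.linearCombination _ _) a c

lemma invFourier_apply (c : PontryaginDual G →₀ ℂ) (x : G) :
    invFourier c x = c.sum fun γ z => z * (γ x : ℂ) := by
  simp only [invFourier, Finsupp.sum, ContinuousMap.sum_apply]
  rfl

/-- The trigonometric polynomial with a given finitely supported family of Fourier coefficients. -/
def ofCoef (c : PontryaginDual G →₀ ℂ) : trigPoly G := ⟨invFourier c, invFourier_mem c⟩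

lemma exists_ofCoef_eq (f : trigPoly G) : ∃ c, ofCoef c = f := by
  obtain ⟨c, hc⟩ := (Finsupp.mem_span_range_iff_exists_finsupp).1 f.2
  exact ⟨c, Subtype.ext hc⟩

lemma ofCoef_eq_sum (c : PontryaginDual G →₀ ℂ) :
    ofCoef c = ∑ γ ∈ c.support, c γ • ofCoef (Finsupp.single γ 1) := by
  refine Subtype.ext ?_
  simp [ofCoef, invFourier, Finsupp.sum]

variable [IsTopologicalGroup G] [CompactSpace G] [MeasurableSpace G] [BorelSpace G]
  (μ : Measure G) [IsProbabilityMeasure μ]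

lemma integrable_mul_conj_char {h : G → ℂ} (hh : Integrable h μ) (γ : PontryaginDual G) :
    Integrable (fun x => h x * conj (γ x : ℂ)) μ :=
  hh.mul_of_top_left (Continuous.memLp_of_hasCompactSupport
    (Complex.continuous_conj.comp (charMap γ).continuous) (HasCompactSupport.of_compactSpace _))

/-- Parseval's formula for the pairing of an integrable function with a polynomial. -/
lemma integral_mul_conj_invFourier {h : G → ℂ} (hh : Integrable h μ)
    (d : PontryaginDual G →₀ ℂ) :
    ∫ x, h x * conj (invFourier d x) ∂μ
      = d.sum fun γ z => fourierCoef μ h γ * conj z := by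
  simp only [invFourier_apply, Finsupp.sum, map_sum, map_mul, Finset.mul_sum]
  rw [integral_finsetSum]
  · refine Finset.sum_congr rfl fun γ _ => ?_
    rw [fourierCoef, ← integral_mul_const]
    congr 1
    ext x
    ring
  · intro γ _
    refine ((integrable_mul_conj_char μ hh γ).mul_const (conj (d γ))).congr (.of_forall fun x => ?_)
    simp only
    ring

variable [μ.IsHaarMeasure]

lemma integral_char_mul_conj_self (γ : PontryaginDual G) :
    ∫ x, (γ x : ℂ) * conj (γ x : ℂ) ∂μ = 1 := by
  simp [Complex.mul_conj, Circle.normSq_coe]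

lemma fourierCoef_invFourier (c : PontryaginDual G →₀ ℂ) (γ : PontryaginDual G) :
    fourierCoef μ (invFourier c) γ = c γ := by
  simp only [fourierCoef, invFourier_apply, Finsupp.sum, Finset.sum_mul, mul_assoc]
  have hint (η : PontryaginDual G) : Integrable (fun x => c η * ((η x : ℂ) * conj (γ x : ℂ))) μ :=
    (integrable_mul_conj_char μ
      (integrable_of_continuous μ (charMap η).continuous) γ).const_mul (c η)
  rw [integral_finsetSum _ fun η _ => hint η]
  simp only [integral_const_mul]
  rw [Finset.sum_eq_single γ]
  · rw [integral_char_mul_conj_self, mul_one]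
  · intro η _ hη
    rw [integral_char_mul_conj μ γ η hη, mul_zero]
  · intro h
    rw [Finsupp.notMem_support_iff.1 h, zero_mul]

@[simp]
lemma fourier_ofCoef (c : PontryaginDual G →₀ ℂ) : fourier μ (ofCoef c) = c := by
  ext γ
  exact fourierCoef_invFourier μ c γ

lemma norm_fourierCoef_le (a : Lp ℂ 1 μ) (γ : PontryaginDual G) : ‖fourierCoef μ a γ‖ ≤ ‖a‖ := by
  rw [L1.norm_eq_integral_norm]
  refine (norm_integral_le_integral_norm _).trans_eq ?_
  simp only [norm_mul, RCLike.norm_conj, Circle.norm_coe, mul_one]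

lemma conv_invFourier (a : Lp ℂ 1 μ) {c e : PontryaginDual G →₀ ℂ}
    (he : ∀ γ, e γ = fourierCoef μ a γ * c γ) (x : G) :
    conv μ a (invFourier c) x = invFourier e x := by
  have ha : Integrable (fun y => a (x * y⁻¹)) μ := by
    simpa only [div_eq_mul_inv] using (L1.integrable_coeFn a).comp_div_left x
  have hsub : e.support ⊆ c.support := fun γ hγ => by
    rw [Finsupp.mem_support_iff, he] at hγ
    exact Finsupp.mem_support_iff.2 (right_ne_zero_of_mul hγ)
  rw [invFourier_apply, Finsupp.sum_of_support_subset _ hsub _ (by simp)]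
  simp only [conv, invFourier_apply, Finsupp.sum, Finset.mul_sum]
  rw [integral_finsetSum]
  · refine Finset.sum_congr rfl fun γ _ => ?_
    rw [he, mul_right_comm, ← conv_char, conv, ← integral_mul_const]
    congr 1
    ext y
    change _ = a (x * y⁻¹) * (γ y : ℂ) * c γ
    ring
  · intro γ _
    refine ((ha.mul_of_top_left ((charMap γ).continuous.memLp_of_hasCompactSupport
      (HasCompactSupport.of_compactSpace _))).mul_const (c γ)).congr (.of_forall fun y => ?_)
    change a (x * y⁻¹) * (γ y : ℂ) * c γ = _
    ring

lemma convPoly_ofCoef (a : Lp ℂ 1 μ) {c e : PontryaginDual G →₀ ℂ}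
    (he : ∀ γ, e γ = fourierCoef μ a γ * c γ) : convPoly μ a (ofCoef c) = ofCoef e :=
  Subtype.ext (ContinuousMap.ext fun x =>
    (convPoly_apply μ a (ofCoef c) x).trans (conv_invFourier μ a he x))

end Fourier

section Norms

variable {G : Type*} [CommGroup G] [TopologicalSpace G]
  [IsTopologicalGroup G] [CompactSpace G] [MeasurableSpace G] [BorelSpace G]
  (μ : Measure G) [IsProbabilityMeasure μ] [μ.IsHaarMeasure]

lemma norm_toLq (q : ℝ≥0∞) (f : C(G, ℂ)) : ‖toLq μ q f‖ = (eLpNorm f q μ).toReal :=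
  Lp.norm_toLp _ _

lemma memLp_continuousMap (q : ℝ≥0∞) (f : C(G, ℂ)) : MemLp f q μ :=
  Continuous.memLp_of_hasCompactSupport f.continuous (HasCompactSupport.of_compactSpace _)

lemma norm_toLq_mono {p q : ℝ≥0∞} (hpq : p ≤ q) (f : C(G, ℂ)) :
    ‖toLq μ p f‖ ≤ ‖toLq μ q f‖ := by
  rw [norm_toLq, norm_toLq]
  exact ENNReal.toReal_mono (memLp_continuousMap μ q f).2.ne
    (eLpNorm_le_eLpNorm_of_exponent_le hpq f.continuous.aestronglyMeasurable)

lemma norm_toLq_le_norm (q : ℝ≥0∞) (f : C(G, ℂ)) : ‖toLq μ q f‖ ≤ ‖f‖ := by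
  refine (norm_toLq_mono μ (le_top : q ≤ ∞) f).trans ?_
  rw [norm_toLq]
  refine ENNReal.toReal_le_of_le_ofReal (norm_nonneg _) ?_
  simpa using eLpNorm_le_of_ae_bound (p := ∞) (μ := μ) (f := f)
    (.of_forall fun x => f.norm_coe_le_norm x)

lemma norm_toLq_two_invFourier (c : PontryaginDual G →₀ ℂ) :
    ‖toLq μ 2 (invFourier c)‖ = l2norm c := by
  have h := ContinuousMap.inner_toLp (𝕜 := ℂ) μ (invFourier c) (invFourier c)
  rw [integral_mul_conj_invFourier μ (integrable_of_continuous μ (map_continuous _))] at h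
  rw [l2norm, ← Real.sqrt_sq (norm_nonneg _)]
  congr 1
  have h2 : (((‖toLq μ 2 (invFourier c)‖ ^ 2 : ℝ)) : ℂ) = ((c.sum fun _ z => ‖z‖ ^ 2 : ℝ) : ℂ) := by
    push_cast
    refine (inner_self_eq_norm_sq_to_K (𝕜 := ℂ) _).symm.trans (h.trans ?_)
    simp only [Finsupp.sum, fourierCoef_invFourier, Complex.ofReal_sum]
    refine Finset.sum_congr rfl fun γ _ => ?_
    rw [Complex.mul_conj, Complex.normSq_eq_norm_sq]
  exact_mod_cast h2

lemma l2norm_fourier_le_polyLpNorm {p : ℝ≥0∞} (hp : 2 ≤ p) (f : trigPoly G) :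
    l2norm (fourier μ f) ≤ polyLpNorm μ p f := by
  obtain ⟨c, rfl⟩ := exists_ofCoef_eq f
  rw [fourier_ofCoef, ← norm_toLq_two_invFourier μ]
  exact norm_toLq_mono μ hp _

lemma polyLpNorm_le_supNorm (p : ℝ≥0∞) (f : trigPoly G) : polyLpNorm μ p f ≤ supNorm f :=
  norm_toLq_le_norm μ p _

lemma l2norm_fourier_le_supNorm (f : trigPoly G) : l2norm (fourier μ f) ≤ supNorm f :=
  (l2norm_fourier_le_polyLpNorm μ le_rfl f).trans (polyLpNorm_le_supNorm μ 2 f)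

lemma norm_toLq_invFourier_le {q : ℝ≥0∞} (hq : q ≤ 2) (c : PontryaginDual G →₀ ℂ) :
    ‖toLq μ q (invFourier c)‖ ≤ l2norm c :=
  (norm_toLq_mono μ hq _).trans (norm_toLq_two_invFourier μ c).le

end Norms

section IsCentralizer

variable {G : Type*} [CommGroup G] [TopologicalSpace G]
  [IsTopologicalGroup G] [CompactSpace G] [MeasurableSpace G] [BorelSpace G]
  {μ : Measure G} [IsProbabilityMeasure μ] [μ.IsHaarMeasure]

lemma mho_ofCoef (φ : ℝ → ℝ) (q : ℝ≥0∞) (c : PontryaginDual G →₀ ℂ) :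
    mho μ φ q (ofCoef c) = toLq μ q (invFourier (kaltonPeck φ c)) := by
  rw [mho, fourier_ofCoef]

lemma isQuasilinear_mho {φ : ℝ → ℝ} {L : NNReal} (hφ : LipschitzOnWith L φ (Set.Ici 0))
    {q : ℝ≥0∞} (hq : q ≤ 2) {N : trigPoly G → ℝ} (hN : ∀ f, l2norm (fourier μ f) ≤ N f) :
    IsQuasilinear N (mho μ φ q) := by
  refine ⟨fun a f => ?_, 6 * L, fun f g => ?_⟩
  · obtain ⟨c, rfl⟩ := exists_ofCoef_eq f
    have : a • ofCoef c = ofCoef (a • c) := Subtype.ext (invFourier_smul a c).symm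
    rw [this, mho_ofCoef, mho_ofCoef, kaltonPeck_smul, invFourier_smul]
    rfl
  · have hf := hN f
    have hg := hN g
    obtain ⟨c, rfl⟩ := exists_ofCoef_eq f
    obtain ⟨d, rfl⟩ := exists_ofCoef_eq g
    have : ofCoef c + ofCoef d = ofCoef (c + d) := Subtype.ext (invFourier_add c d).symm
    rw [this, mho_ofCoef, mho_ofCoef, mho_ofCoef]
    rw [fourier_ofCoef] at hf hg
    calc _ = ‖toLq μ q (invFourier (kaltonPeck φ (c + d) - kaltonPeck φ c - kaltonPeck φ d))‖ := by
          rw [invFourier_sub, invFourier_sub]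
          rfl
      _ ≤ _ := (norm_toLq_invFourier_le μ hq _).trans (l2norm_kaltonPeck_add_sub_sub_le hφ c d)
      _ ≤ _ := by gcongr

/-- The map `℧` is a centralizer for every norm that dominates the `L₂`-norm, with values in every
`L_q` with `q ≤ 2`: by Plancherel this is the statement that the Kalton-Peck map commutes up to a
bounded error with the multiplier `â`. -/
lemma isCentralizer_mho {φ : ℝ → ℝ} {L : NNReal} (hφ : LipschitzOnWith L φ (Set.Ici 0))
    {q : ℝ≥0∞} (hq : q ≤ 2) {N : trigPoly G → ℝ} (hN : ∀ f, l2norm (fourier μ f) ≤ N f) :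
    IsCentralizer N (mho μ φ q) := by
  refine ⟨isQuasilinear_mho hφ hq hN, 2 * L, fun a f => ?_⟩
  have hf := hN f
  obtain ⟨c, rfl⟩ := exists_ofCoef_eq f
  rw [fourier_ofCoef] at hf
  let mul (c : PontryaginDual G →₀ ℂ) : PontryaginDual G →₀ ℂ :=
    Finsupp.onFinset c.support (fun γ => fourierCoef μ a γ * c γ) fun γ h =>
      Finsupp.mem_support_iff.2 (right_ne_zero_of_mul h)
  rw [convPoly_ofCoef μ a (e := mul c) (fun _ => rfl), mho_ofCoef, mho_ofCoef]
  have hconv : ∀ x, conv μ a (toLq μ q (invFourier (kaltonPeck φ c))) x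
      = invFourier (mul (kaltonPeck φ c)) x := by
    intro x
    rw [← conv_invFourier μ a (c := kaltonPeck φ c) (fun _ => rfl) x]
    refine integral_congr_ae ?_
    filter_upwards [MemLp.coeFn_toLp (memLp_continuousMap μ q (invFourier (kaltonPeck φ c)))]
      with y hy
    exact congrArg _ hy
  have hae : (fun x => toLq μ q (invFourier (kaltonPeck φ (mul c))) x
      - conv μ a (toLq μ q (invFourier (kaltonPeck φ c))) x)
      =ᵐ[μ] invFourier (kaltonPeck φ (mul c) - mul (kaltonPeck φ c)) := by
    filter_upwards [MemLp.coeFn_toLp (memLp_continuousMap μ q (invFourier (kaltonPeck φ (mul c))))]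
      with x hx
    rw [hconv, invFourier_sub, ContinuousMap.sub_apply]
    exact congrArg (· - _) hx
  rw [eLpNorm_congr_ae hae]
  refine (ENNReal.le_ofReal_iff_toReal_le (memLp_continuousMap μ q _).2.ne ?_).2 ?_
  · have := (l2norm_nonneg c).trans hf
    positivity
  rw [← norm_toLq]
  refine (norm_toLq_invFourier_le μ hq _).trans ((l2norm_kaltonPeck_mul_sub_le hφ
    (norm_fourierCoef_le μ a) (norm_nonneg a) (fun _ => rfl) (fun _ => rfl)).trans ?_)
  gcongr

end IsCentralizer

/-! ### Rudin-Shapiro polynomials and nontriviality -/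

section FlatPolynomials

variable {G : Type*} [CommGroup G] [TopologicalSpace G]

/-- A family of coefficients is flat on `A` if its entries have modulus one on `A` and vanish
elsewhere. -/
def IsFlat {I : Type*} (A : Finset I) (c : I →₀ ℂ) : Prop :=
  (∀ i ∈ A, ‖c i‖ = 1) ∧ ∀ i ∉ A, c i = 0

lemma IsFlat.support_eq {I : Type*} {A : Finset I} {c : I →₀ ℂ} (h : IsFlat A c) :
    c.support = A := by
  ext i
  rw [Finsupp.mem_support_iff]
  refine ⟨fun hi => by_contra fun hA => hi (h.2 i hA), fun hA h0 => ?_⟩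
  simpa [h0] using h.1 i hA

lemma IsFlat.l2norm_eq {I : Type*} {A : Finset I} {c : I →₀ ℂ} (h : IsFlat A c) :
    l2norm c = Real.sqrt A.card := by
  rw [KaltonPeck.l2norm_eq h.support_eq.subset, Finset.sum_congr rfl fun i hi => by rw [h.1 i hi]]
  simp

lemma IsFlat.kaltonPeck_eq {I : Type*} {A : Finset I} {c : I →₀ ℂ} (h : IsFlat A c)
    (φ : ℝ → ℝ) : kaltonPeck φ c = (φ (Real.log (Real.sqrt A.card)) : ℂ) • c := by
  ext i
  simp only [kaltonPeck, Finsupp.mapRange_apply, Finsupp.smul_apply, smul_eq_mul]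
  by_cases hi : i ∈ A
  · rw [h.1 i hi, div_one, h.l2norm_eq, mul_comm]
  · rw [h.2 i hi, zero_mul, mul_zero]

/-- The Fourier coefficients of `δ f`, for a character `δ`. -/
def shift (δ : PontryaginDual G) (c : PontryaginDual G →₀ ℂ) : PontryaginDual G →₀ ℂ :=
  Finsupp.equivMapDomain (Equiv.mulLeft δ) c

lemma shift_apply (δ : PontryaginDual G) (c : PontryaginDual G →₀ ℂ) (γ : PontryaginDual G) :
    shift δ c γ = c (δ⁻¹ * γ) := rfl

lemma invFourier_shift (δ : PontryaginDual G) (c : PontryaginDual G →₀ ℂ) (x : G) :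
    invFourier (shift δ c) x = (δ x : ℂ) * invFourier c x := by
  rw [invFourier_apply, invFourier_apply, shift, Finsupp.equivMapDomain_eq_mapDomain,
    Finsupp.sum_mapDomain_index (by simp) (by intros; ring), Finsupp.mul_sum]
  refine Finsupp.sum_congr fun γ _ => ?_
  have : ((Equiv.mulLeft δ γ) x : ℂ) = (δ x : ℂ) * (γ x : ℂ) := Circle.coe_mul _ _
  rw [this]
  ring

/-- Rudin-Shapiro pairs: `(P, Q)` is replaced by `(P + δ Q, P - δ Q)`, where `δ` moves the spectrum
off itself; the identity `|P|² + |Q|² = 2 ^ (k + 1)` is propagated by the parallelogram law. -/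
lemma exists_rudinShapiro [Infinite (PontryaginDual G)] (k : ℕ) :
    ∃ (A : Finset (PontryaginDual G)) (c d : PontryaginDual G →₀ ℂ),
      A.card = 2 ^ k ∧ IsFlat A c ∧ IsFlat A d ∧
      ∀ x : G, ‖invFourier c x‖ ^ 2 + ‖invFourier d x‖ ^ 2 = 2 ^ (k + 1) := by
  classical
  induction k with
  | zero =>
    have h : IsFlat {(1 : PontryaginDual G)} (Finsupp.single 1 1) :=
      ⟨by simp, fun i hi => Finsupp.single_eq_of_ne (by simpa using hi)⟩
    refine ⟨{1}, Finsupp.single 1 1, Finsupp.single 1 1, by simp, h, h, fun x => ?_⟩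
    rw [invFourier_apply, Finsupp.sum_single_index (by simp)]
    norm_num
  | succ k ih =>
    obtain ⟨A, c, d, hA, hc, hd, hcd⟩ := ih
    obtain ⟨δ, hδ⟩ := Infinite.exists_notMem_finset (Finset.image₂ (fun a b => a * b⁻¹) A A)
    have hdisj : ∀ γ ∈ A, δ⁻¹ * γ ∉ A := fun γ hγ h => hδ
      (Finset.mem_image₂.2 ⟨γ, hγ, δ⁻¹ * γ, h, by group⟩)
    let A' := A ∪ A.map (Equiv.mulLeft δ).toEmbedding
    have hmem : ∀ γ, γ ∈ A' ↔ γ ∈ A ∨ δ⁻¹ * γ ∈ A := by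
      intro γ
      simp only [A', Finset.mem_union, Finset.mem_map_equiv]
      rfl
    have hcard : A'.card = 2 ^ (k + 1) := by
      rw [Finset.card_union_of_disjoint, Finset.card_map, hA]
      · ring
      · rw [Finset.disjoint_left]
        intro γ hγ h
        exact hdisj γ hγ (Finset.mem_map_equiv.1 h)
    refine ⟨A', c + shift δ d, c - shift δ d, hcard, ⟨fun γ hγ => ?_, fun γ hγ => ?_⟩,
      ⟨fun γ hγ => ?_, fun γ hγ => ?_⟩, fun x => ?_⟩
    · rw [Finsupp.add_apply, shift_apply]
      rcases (hmem γ).1 hγ with h | h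
      · rw [hd.2 _ (hdisj γ h), add_zero, hc.1 γ h]
      · rw [hc.2 γ fun h' => hdisj γ h' h, zero_add, hd.1 _ h]
    · rw [hmem, not_or] at hγ
      rw [Finsupp.add_apply, shift_apply, hc.2 γ hγ.1, hd.2 _ hγ.2, add_zero]
    · rw [Finsupp.sub_apply, shift_apply]
      rcases (hmem γ).1 hγ with h | h
      · rw [hd.2 _ (hdisj γ h), sub_zero, hc.1 γ h]
      · rw [hc.2 γ fun h' => hdisj γ h' h, zero_sub, norm_neg, hd.1 _ h]
    · rw [hmem, not_or] at hγ
      rw [Finsupp.sub_apply, shift_apply, hc.2 γ hγ.1, hd.2 _ hγ.2, sub_zero]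
    · rw [invFourier_add, invFourier_sub, ContinuousMap.add_apply, ContinuousMap.sub_apply,
        invFourier_shift]
      have := parallelogram_law_with_norm ℝ (invFourier c x) ((δ x : ℂ) * invFourier d x)
      rw [norm_mul, Circle.norm_coe, one_mul] at this
      rw [pow_succ _ (k + 1), ← hcd x]
      linarith

/-- The Fourier coefficients of the translate `f(x ·)`. -/
def translate (x : G) (c : PontryaginDual G →₀ ℂ) : PontryaginDual G →₀ ℂ :=
  Finsupp.onFinset c.support (fun γ => c γ * (γ x : ℂ)) fun _ h =>
    Finsupp.mem_support_iff.2 (left_ne_zero_of_mul h)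

lemma translate_apply (x : G) (c : PontryaginDual G →₀ ℂ) (γ : PontryaginDual G) :
    translate x c γ = c γ * (γ x : ℂ) := rfl

lemma IsFlat.translate {A : Finset (PontryaginDual G)} {c : PontryaginDual G →₀ ℂ}
    (h : IsFlat A c) (x : G) : IsFlat A (translate x c) := by
  refine ⟨fun γ hγ => ?_, fun γ hγ => ?_⟩
  · rw [translate_apply, norm_mul, Circle.norm_coe, h.1 γ hγ, mul_one]
  · rw [translate_apply, h.2 γ hγ, zero_mul]

lemma invFourier_translate (x : G) (c : PontryaginDual G →₀ ℂ) (y : G) :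
    invFourier (translate x c) y = invFourier c (x * y) := by
  have hsub : (translate x c).support ⊆ c.support := Finsupp.support_onFinset_subset
  rw [invFourier_apply, invFourier_apply, Finsupp.sum_of_support_subset _ hsub _ (by simp),
    Finsupp.sum]
  refine Finset.sum_congr rfl fun γ _ => ?_
  rw [translate_apply, map_mul, Circle.coe_mul, mul_assoc]

lemma norm_invFourier_translate_le [IsTopologicalGroup G] [CompactSpace G] (x : G)
    (c : PontryaginDual G →₀ ℂ) : ‖invFourier (translate x c)‖ ≤ ‖invFourier c‖ :=
  (ContinuousMap.norm_le _ (norm_nonneg _)).2 fun y => by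
    rw [invFourier_translate]
    exact ContinuousMap.norm_coe_le_norm _ _

end FlatPolynomials

section Nontrivial

variable {G : Type*} [CommGroup G] [TopologicalSpace G]
  [IsTopologicalGroup G] [CompactSpace G] [MeasurableSpace G] [BorelSpace G]
  {μ : Measure G} [IsProbabilityMeasure μ] {q : ℝ≥0∞}

lemma integrable_coeFn_Lp (hq : 1 ≤ q) (h : Lp ℂ q μ) : Integrable h μ :=
  (Lp.memLp h).integrable hq

lemma norm_integral_mul_conj_le (hq : 1 ≤ q) (h : Lp ℂ q μ) (g : C(G, ℂ)) :
    ‖∫ x, h x * conj (g x) ∂μ‖ ≤ ‖h‖ * ‖g‖ := by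
  have hh := integrable_coeFn_Lp hq h
  have h1 : ∫ x, ‖h x‖ ∂μ ≤ ‖h‖ := by
    rw [integral_norm_eq_lintegral_enorm hh.1, ← eLpNorm_one_eq_lintegral_enorm, Lp.norm_def]
    exact ENNReal.toReal_mono (Lp.memLp h).2.ne (eLpNorm_le_eLpNorm_of_exponent_le hq hh.1)
  calc _ ≤ ∫ x, ‖h x‖ * ‖g‖ ∂μ := by
        refine norm_integral_le_of_norm_le (hh.norm.mul_const _) (.of_forall fun x => ?_)
        rw [norm_mul, RCLike.norm_conj]
        gcongr
        exact g.norm_coe_le_norm x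
    _ ≤ ‖h‖ * ‖g‖ := by
        rw [integral_mul_const]
        gcongr

/-- The Fourier coefficient at `γ` as a linear form on `L_q(G)`, `q ≥ 1`. -/
def coefLp (hq : 1 ≤ q) (γ : PontryaginDual G) : Lp ℂ q μ →ₗ[ℂ] ℂ where
  toFun h := fourierCoef μ h γ
  map_add' f g := by
    rw [fourierCoef, fourierCoef, fourierCoef, ← integral_add
      (integrable_mul_conj_char μ (integrable_coeFn_Lp hq f) γ)
      (integrable_mul_conj_char μ (integrable_coeFn_Lp hq g) γ)]
    refine integral_congr_ae ?_
    filter_upwards [Lp.coeFn_add f g] with x hx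
    rw [hx, Pi.add_apply, add_mul]
  map_smul' a f := by
    rw [fourierCoef, fourierCoef, RingHom.id_apply, smul_eq_mul, ← integral_const_mul]
    refine integral_congr_ae ?_
    filter_upwards [Lp.coeFn_smul a f] with x hx
    rw [hx, Pi.smul_apply, smul_eq_mul, mul_assoc]

variable [μ.IsHaarMeasure]

lemma coefLp_toLq_invFourier (hq : 1 ≤ q) (c : PontryaginDual G →₀ ℂ) (γ : PontryaginDual G) :
    coefLp hq γ (toLq μ q (invFourier c)) = c γ := by
  rw [← fourierCoef_invFourier μ c γ]
  refine integral_congr_ae ?_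
  filter_upwards [MemLp.coeFn_toLp (memLp_continuousMap μ q (invFourier c))] with x hx
  exact congrArg (· * _) hx

/-- A linear map at finite distance from `℧` forces a bound on `φ` along flat polynomials. Testing
`℧ - Λ` on the translates of a flat polynomial `f` against these translates and averaging over `G`
leaves of `Λ` only its diagonal coefficients, which are bounded because `℧` vanishes on
characters. -/
lemma abs_phi_le_of_isFlat {φ : ℝ → ℝ} (hφ0 : φ 0 = 0) (hq : 1 ≤ q)
    (Λ : trigPoly G →ₗ[ℂ] Lp ℂ q μ) {K : ℝ} (hK : 0 ≤ K)
    (hΛ : ∀ f, ‖mho μ φ q f - Λ f‖ ≤ K * supNorm f)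
    {A : Finset (PontryaginDual G)} {c : PontryaginDual G →₀ ℂ} (hA : 0 < A.card)
    (hc : IsFlat A c) (hsup : ‖invFourier c‖ ^ 2 ≤ 2 * A.card) :
    |φ (Real.log (Real.sqrt A.card))| ≤ 3 * K := by
  set r : ℝ := φ (Real.log (Real.sqrt A.card))
  let b (γ η : PontryaginDual G) : ℂ := coefLp hq η (Λ (ofCoef (Finsupp.single γ 1)))
  have hb : ∀ γ, ‖b γ γ‖ ≤ K := by
    intro γ
    have h1 : mho μ φ q (ofCoef (Finsupp.single γ 1)) = 0 := by
      have hflat : IsFlat {γ} (Finsupp.single γ (1 : ℂ)) :=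
        ⟨by simp, fun i hi => Finsupp.single_eq_of_ne (by simpa using hi)⟩
      rw [mho_ofCoef, hflat.kaltonPeck_eq]
      simp only [Finset.card_singleton, Nat.cast_one, Real.sqrt_one, Real.log_one, hφ0,
        Complex.ofReal_zero, zero_smul]
      rfl
    have hchar : ‖charMap γ‖ ≤ 1 := (ContinuousMap.norm_le _ zero_le_one).2 fun x =>
      (Circle.norm_coe _).le
    have h2 : supNorm (ofCoef (Finsupp.single γ (1 : ℂ))) ≤ 1 := by
      simpa [supNorm, ofCoef, invFourier] using hchar
    have h3 := hΛ (ofCoef (Finsupp.single γ 1))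
    rw [h1, zero_sub, Lp.norm_neg] at h3
    calc ‖b γ γ‖ ≤ ‖Λ (ofCoef (Finsupp.single γ 1))‖ * ‖charMap γ‖ :=
          norm_integral_mul_conj_le hq _ (charMap γ)
      _ ≤ K * 1 * 1 := by
          gcongr
          exact h3.trans (by gcongr)
      _ = K := by ring
  let D (x : G) : ℂ := ∑ η ∈ A, (r * translate x c η - ∑ γ ∈ A, translate x c γ * b γ η)
    * conj (translate x c η)
  have hD : ∀ x, ‖D x‖ ≤ K * (2 * A.card) := by
    intro x
    let h : Lp ℂ q μ := mho μ φ q (ofCoef (translate x c)) - Λ (ofCoef (translate x c))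
    have hflat := hc.translate x
    have h1 : D x = ∫ y, h y * conj (invFourier (translate x c) y) ∂μ := by
      rw [integral_mul_conj_invFourier μ (integrable_coeFn_Lp hq h), Finsupp.sum,
        hflat.support_eq]
      refine Finset.sum_congr rfl fun η _ => ?_
      congr 1
      change _ = coefLp hq η h
      rw [map_sub, mho_ofCoef, coefLp_toLq_invFourier, hflat.kaltonPeck_eq,
        ofCoef_eq_sum (translate x c), hflat.support_eq, map_sum, map_sum]
      simp only [map_smul, smul_eq_mul, Finsupp.smul_apply]
      rfl
    have h2 : ‖invFourier (translate x c)‖ ≤ ‖invFourier c‖ := norm_invFourier_translate_le x c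
    rw [h1]
    calc _ ≤ ‖h‖ * ‖invFourier (translate x c)‖ := norm_integral_mul_conj_le hq h _
      _ ≤ (K * ‖invFourier (translate x c)‖) * ‖invFourier (translate x c)‖ := by
          gcongr
          exact hΛ _
      _ ≤ (K * ‖invFourier c‖) * ‖invFourier c‖ := by gcongr
      _ = K * ‖invFourier c‖ ^ 2 := by ring
      _ ≤ _ := by gcongr
  have hsq : ∀ η ∈ A, c η * conj (c η) = 1 := fun η hη => by
    rw [Complex.mul_conj, Complex.normSq_eq_norm_sq, hc.1 η hη]
    simp
  have hDint : ∫ x, D x ∂μ = ∑ η ∈ A, ((r : ℂ) - b η η) := by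
    have hint : ∀ γ η : PontryaginDual G,
        Integrable (fun x => (γ x : ℂ) * conj (η x : ℂ)) μ := fun γ η =>
      integrable_mul_conj_char μ (integrable_of_continuous μ (charMap γ).continuous) η
    have hDx : ∀ x, D x = ∑ η ∈ A, (((r : ℂ) * (c η * conj (c η))) * ((η x : ℂ) * conj (η x : ℂ))
        - ∑ γ ∈ A, (c γ * b γ η * conj (c η)) * ((γ x : ℂ) * conj (η x : ℂ))) := by
      intro x
      refine Finset.sum_congr rfl fun η _ => ?_
      simp only [translate_apply, map_mul, sub_mul, Finset.sum_mul]
      congr 1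
      · ring
      · exact Finset.sum_congr rfl fun γ _ => by ring
    simp only [hDx]
    have hint2 : ∀ η : PontryaginDual G, Integrable (fun x => ∑ γ ∈ A,
        (c γ * b γ η * conj (c η)) * ((γ x : ℂ) * conj (η x : ℂ))) μ := fun η =>
      integrable_finsetSum _ fun γ _ => (hint γ η).const_mul _
    have hint3 : ∀ η : PontryaginDual G, Integrable (fun x =>
        ((r : ℂ) * (c η * conj (c η))) * ((η x : ℂ) * conj (η x : ℂ)) - ∑ γ ∈ A,
          (c γ * b γ η * conj (c η)) * ((γ x : ℂ) * conj (η x : ℂ))) μ := fun η =>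
      ((hint η η).const_mul _).sub (hint2 η)
    rw [integral_finsetSum _ fun η _ => hint3 η]
    refine Finset.sum_congr rfl fun η hη => ?_
    rw [integral_sub ((hint η η).const_mul _) (hint2 η), integral_const_mul,
      integral_char_mul_conj_self, integral_finsetSum _ fun γ _ => (hint γ η).const_mul _]
    simp only [integral_const_mul]
    rw [Finset.sum_eq_single_of_mem η hη fun γ _ hne => by
      rw [integral_char_mul_conj μ η γ hne, mul_zero], integral_char_mul_conj_self]
    linear_combination ((r : ℂ) - b η η) * hsq η hη
  have hle : ‖∫ x, D x ∂μ‖ ≤ K * (2 * A.card) := by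
    simpa using norm_integral_le_of_norm_le_const (μ := μ) (.of_forall hD)
  rw [hDint, Finset.sum_sub_distrib, Finset.sum_const, nsmul_eq_mul] at hle
  have hbsum : ‖∑ η ∈ A, b η η‖ ≤ A.card * K := by
    refine (norm_sum_le _ _).trans ((Finset.sum_le_sum fun η _ => hb η).trans ?_)
    rw [Finset.sum_const, nsmul_eq_mul]
  have hnr : ‖(A.card : ℂ) * (r : ℂ)‖ = A.card * |r| := by
    rw [norm_mul, Complex.norm_natCast, Complex.norm_real, Real.norm_eq_abs]
  have h := (norm_le_norm_sub_add ((A.card : ℂ) * (r : ℂ)) (∑ η ∈ A, b η η)).trans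
    (add_le_add hle hbsum)
  rw [hnr] at h
  have hA' : (0 : ℝ) < A.card := by exact_mod_cast hA
  refine le_of_mul_le_mul_left (h.trans_eq ?_) hA'
  ring

/-- The Rudin-Shapiro polynomials bound `φ` on an arithmetic progression, and the Lipschitz
condition spreads the bound to `[0, ∞)`. -/
lemma not_isTrivialQuasilinear_mho [Infinite (PontryaginDual G)] {φ : ℝ → ℝ} {L : NNReal}
    (hφ : LipschitzOnWith L φ (Set.Ici 0)) (hφ0 : φ 0 = 0)
    (hunb : ¬ ∃ M : ℝ, ∀ t : ℝ, 0 ≤ t → |φ t| ≤ M) (hq : 1 ≤ q) {N : trigPoly G → ℝ}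
    (hN0 : ∀ f, 0 ≤ N f) (hN : ∀ f, N f ≤ supNorm f) :
    ¬ IsTrivialQuasilinear N (mho μ φ q) := by
  rintro ⟨Λ, K, hΛ⟩
  have hΛ' : ∀ f, ‖mho μ φ q f - Λ f‖ ≤ |K| * supNorm f := fun f =>
    (hΛ f).trans ((mul_le_mul_of_nonneg_right (le_abs_self K) (hN0 f)).trans
      (mul_le_mul_of_nonneg_left (hN f) (abs_nonneg K)))
  -- The values of `log √n` at the powers of two form the multiples of `a`.
  set a : ℝ := Real.log 2 / 2
  have ha0 : 0 < a := by have := Real.log_pos one_lt_two; positivity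
  have hk : ∀ k : ℕ, |φ (k * a)| ≤ 3 * |K| := by
    intro k
    obtain ⟨A, c, d, hA, hc, -, hcd⟩ := exists_rudinShapiro (G := G) k
    have hA' : (A.card : ℝ) = 2 ^ k := by rw [hA]; push_cast; rfl
    have h2 : ‖invFourier c‖ ^ 2 ≤ 2 * A.card := by
      rw [← Real.le_sqrt (norm_nonneg _) (by positivity)]
      refine (ContinuousMap.norm_le _ (Real.sqrt_nonneg _)).2 fun x => Real.le_sqrt_of_sq_le ?_
      have := hcd x
      rw [hA', ← pow_succ']
      nlinarith [sq_nonneg ‖invFourier d x‖]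
    have h := abs_phi_le_of_isFlat hφ0 hq Λ (abs_nonneg K) hΛ' (hA ▸ by positivity) hc h2
    rw [hA', Real.log_sqrt (by positivity), Real.log_pow, mul_div_assoc] at h
    exact h
  refine hunb ⟨3 * |K| + L * a, fun t ht => ?_⟩
  have h1 : (⌊t / a⌋₊ : ℝ) * a ≤ t :=
    (le_div_iff₀ ha0).1 (Nat.floor_le (by positivity))
  have h2 : t < (⌊t / a⌋₊ + 1) * a := (div_lt_iff₀ ha0).1 (Nat.lt_floor_add_one _)
  have h3 := hφ.dist_le_mul t ht (⌊t / a⌋₊ * a)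
    (show (0 : ℝ) ≤ _ by positivity)
  rw [Real.dist_eq, Real.dist_eq, abs_of_nonneg (a := t - _) (by linarith)] at h3
  have h4 : (L : ℝ) * (t - ⌊t / a⌋₊ * a) ≤ L * a := by
    gcongr
    linarith
  have h5 := abs_sub_abs_le_abs_sub (φ t) (φ (⌊t / a⌋₊ * a))
  have h6 := hk ⌊t / a⌋₊
  linarith

lemma IsTrivialCentralizer.isTrivialQuasilinear {N : trigPoly G → ℝ}
    {Φ : trigPoly G → Lp ℂ q μ} (h : IsTrivialCentralizer N Φ) : IsTrivialQuasilinear N Φ := by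
  obtain ⟨Λ, K, -, h⟩ := h
  exact ⟨Λ, K, h⟩

end Nontrivial

end KaltonPeck

end

theorem theorem3p5 {G : Type*} [CommGroup G] [TopologicalSpace G] [IsTopologicalGroup G]
    [CompactSpace G] [T2Space G] [Infinite G] [MeasurableSpace G] [BorelSpace G]
    (μ : Measure G) [μ.IsHaarMeasure] [IsProbabilityMeasure μ] [μ.Regular]
    (φ : ℝ → ℝ) (hφ : KaltonPeck.IsEssentiallyConcave φ)
    (hunb : ¬ ∃ M : ℝ, ∀ t : ℝ, 0 ≤ t → |φ t| ≤ M) :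
    (KaltonPeck.IsCentralizer KaltonPeck.supNorm (KaltonPeck.mho μ φ 1) ∧
      ¬ KaltonPeck.IsTrivialQuasilinear KaltonPeck.supNorm (KaltonPeck.mho μ φ 1) ∧
      ¬ KaltonPeck.IsTrivialCentralizer KaltonPeck.supNorm (KaltonPeck.mho μ φ 1)) ∧
    ∀ p q : ℝ≥0∞, 1 ≤ q → q ≤ 2 → 2 ≤ p →
      KaltonPeck.IsCentralizer (KaltonPeck.polyLpNorm μ p) (KaltonPeck.mho μ φ q) ∧
      ¬ KaltonPeck.IsTrivialQuasilinear (KaltonPeck.polyLpNorm μ p) (KaltonPeck.mho μ φ q) ∧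
      ¬ KaltonPeck.IsTrivialCentralizer (KaltonPeck.polyLpNorm μ p) (KaltonPeck.mho μ φ q) := by
  obtain ⟨L, hL⟩ := hφ.lipschitz
  have := KaltonPeck.infinite_pontryaginDual μ
  have key : ∀ {N : KaltonPeck.trigPoly G → ℝ} {q : ℝ≥0∞}, 1 ≤ q → q ≤ 2 →
      (∀ f, KaltonPeck.l2norm (KaltonPeck.fourier μ f) ≤ N f) →
      (∀ f, N f ≤ KaltonPeck.supNorm f) →
      KaltonPeck.IsCentralizer N (KaltonPeck.mho μ φ q) ∧
      ¬ KaltonPeck.IsTrivialQuasilinear N (KaltonPeck.mho μ φ q) ∧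
      ¬ KaltonPeck.IsTrivialCentralizer N (KaltonPeck.mho μ φ q) := by
    intro N q hq1 hq2 hlow hup
    have hnt := KaltonPeck.not_isTrivialQuasilinear_mho (μ := μ) hL hφ.map_zero hunb hq1
      (fun f => (KaltonPeck.l2norm_nonneg _).trans (hlow f)) hup
    exact ⟨KaltonPeck.isCentralizer_mho hL hq2 hlow, hnt,
      fun h => hnt h.isTrivialQuasilinear⟩
  refine ⟨key le_rfl one_le_two (KaltonPeck.l2norm_fourier_le_supNorm μ) fun _ => le_rfl, ?_⟩
  intro p q hq1 hq2 hp
  exact key hq1 hq2 (KaltonPeck.l2norm_fourier_le_polyLpNorm μ hp)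
    (KaltonPeck.polyLpNorm_le_supNorm μ p)
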